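/- Fix $\tau\in(2,3)$ and $h_{\min}>0$. In the hidden-variable model on $n$ vertices, the vertices have i.i.d. hidden variables with density $\rho(h)=Ch^{-\tau}$ for $h\ge h_{\min}$ ($C$ the normalizing constant), with mean $\mu$; conditionally on the hidden variables, each pair of distinct vertices with hidden variables $h,h'$ is joined independently with probability $\min(hh'/(\mu n),1)$. Let $H$ be a fixed finite simple graph on $k$ vertices with edge set $E_H$, and let $N_g(H)$ be the number of induced copies of $H$, i.e. the number of $k$-element vertex sets whose induced subgraph is isomorphic to $H$. Define $$B_{g,f}(H)=\max_{(S_1,S_2,S_3)}\Big[|S_1|-|S_2|-\frac{2E_{S_1}+E_{S_1,S_3}}{\tau-1}\Big],$$ where the maximum is over all partitions of the vertices of $H$ into three (possibly empty) sets $S_1,S_2,S_3$ such that $\{u,v\}\in E_H$ for all $u\in S_2$ and all $v\in S_2\cup S_3$ with $v\ne u$; here $E_{S_1}$ is the number of edges of $H$ inside $S_1$ and $E_{S_1,S_3}$ the number of edges of $H$ between $S_1$ and $S_3$. **Theorem (General graphlets, expected).** If the maximum defining $B_{g,f}(H)$ is attained by a unique partition $\mathcal P^*$, then, as $n\to\infty$,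 $$\mathbb E[N_g(H)]=\Theta\Big(n^{\frac{3-\tau}{2}k+\frac{\tau-1}{2}B_{g,f}(H)}\Big),$$ where the implied constants may depend on $H$, $\tau$ and $h_{\min}$ but not on $n$. The order of growth is thus determined by $\mathcal P^*$, at which the bracket equals $B_{g,f}(H)$. -/

import Mathlib

open MeasureTheory ProbabilityTheory Filter Asymptotics

noncomputable section

/-! ### The hidden-variable model -/

/-- The law of a hidden variable: the probability measure with density `C * h ^ (-τ)` on
`[hmin, ∞)`, where `C = (τ - 1) * hmin ^ (τ - 1)` is the normalizing constant. -/
def hiddenVariableLaw (τ hmin : ℝ) : Measure ℝ := paretoMeasure hmin (τ - 1)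

/-- The mean `μ` of a hidden variable. -/
def hiddenVariableMean (τ hmin : ℝ) : ℝ := ∫ h, h ∂(hiddenVariableLaw τ hmin)

/-- The connection probability `p(h, h') = min (h h' / (μ n)) 1` on `n` vertices. -/
def connectionProb (τ hmin : ℝ) (n : ℕ) (h h' : ℝ) : ℝ :=
  min (h * h' / (hiddenVariableMean τ hmin * n)) 1

/-- A sample of the model on the vertices `Fin n`: the hidden variables of the vertices, and one
number in the unit interval for every pair of vertices. -/
abbrev HiddenVariableSample (n : ℕ) : Type := (Fin n → ℝ) × (Sym2 (Fin n) → unitInterval)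

/-- The hidden variables are i.i.d. with law `hiddenVariableLaw`; independently of them, the numbers
attached to the pairs are i.i.d. uniform on the unit interval. -/
def hiddenVariableMeasure (τ hmin : ℝ) (n : ℕ) : Measure (HiddenVariableSample n) :=
  (Measure.pi fun _ : Fin n => hiddenVariableLaw τ hmin).prod
    (Measure.pi fun _ : Sym2 (Fin n) => (volume : Measure unitInterval))

/-- The random graph: distinct vertices `i` and `j` are joined when the uniform number of the pair
lies below `p(h_i, h_j)`. Thus, conditionally on the hidden variables, the pairs are joined
independently, with probabilities `p(h_i, h_j)`. -/
def hiddenVariableGraph (τ hmin : ℝ) (n : ℕ) (ω : HiddenVariableSample n) :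
    SimpleGraph (Fin n) where
  Adj i j := i ≠ j ∧ (ω.2 s(i, j) : ℝ) < connectionProb τ hmin n (ω.1 i) (ω.1 j)
  symm := ⟨fun i j hij =>
    ⟨hij.1.symm, by
      have h := hij.2
      rw [Sym2.eq_swap] at h
      simpa only [connectionProb, mul_comm (ω.1 j) (ω.1 i)] using h⟩⟩
  loopless := ⟨fun _ hi => hi.1 rfl⟩

/-- The number of induced copies of `H` in `G`: the number of vertex sets of `G` that induce a
graph isomorphic to `H`. -/
def graphletCount {V W : Type*} (H : SimpleGraph V) (G : SimpleGraph W) : ℕ :=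
  {S : Set W | Nonempty (G.induce S ≃g H)}.ncard

/-- The expected number of induced copies of `H` in the hidden-variable model on `n` vertices. -/
def expectedGraphletCount {V : Type*} (τ hmin : ℝ) (H : SimpleGraph V) (n : ℕ) : ℝ :=
  ∫ ω, (graphletCount H (hiddenVariableGraph τ hmin n ω) : ℝ) ∂(hiddenVariableMeasure τ hmin n)

/-! ### The optimization problem -/

/-- An (ordered) partition of the vertices into three sets `S₁`, `S₂`, `S₃`, some of which may be
empty, given by the label `0`, `1` or `2` of each vertex. -/
abbrev VertexPartition (V : Type*) : Type _ := V → Fin 3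

namespace VertexPartition

variable {V : Type*}

/-- The set `S₁` of a partition. -/
def S₁ (P : VertexPartition V) : Set V := {v | P v = 0}

/-- The set `S₂` of a partition. -/
def S₂ (P : VertexPartition V) : Set V := {v | P v = 1}

/-- The set `S₃` of a partition. -/
def S₃ (P : VertexPartition V) : Set V := {v | P v = 2}

/-- The number `E_{S₁}` of edges of `H` inside `S₁`. -/
def edgesInS₁ (H : SimpleGraph V) (P : VertexPartition V) : ℕ :=
  {e ∈ H.edgeSet | ∀ v ∈ e, v ∈ S₁ P}.ncard

/-- The number `E_{S₁,S₃}` of edges of `H` between `S₁` and `S₃`. -/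
def edgesS₁S₃ (H : SimpleGraph V) (P : VertexPartition V) : ℕ :=
  {e ∈ H.edgeSet | (∃ u ∈ e, u ∈ S₁ P) ∧ ∃ v ∈ e, v ∈ S₃ P}.ncard

/-- The objective `|S₁| - |S₂| - (2 E_{S₁} + E_{S₁,S₃}) / (τ - 1)`. -/
def objective (τ : ℝ) (H : SimpleGraph V) (P : VertexPartition V) : ℝ :=
  ((S₁ P).ncard : ℝ) - ((S₂ P).ncard : ℝ)
    - (2 * (edgesInS₁ H P : ℝ) + (edgesS₁S₃ H P : ℝ)) / (τ - 1)

/-- The constraint: every vertex of `S₂` is adjacent in `H` to all other vertices of `S₂ ∪ S₃`. -/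
def Feasible (H : SimpleGraph V) (P : VertexPartition V) : Prop :=
  ∀ u ∈ S₂ P, ∀ v ∈ S₂ P ∪ S₃ P, u ≠ v → H.Adj u v

/-- `P` solves the optimization problem: it is feasible and maximizes the objective among the
feasible partitions. -/
def IsOptimizer (τ : ℝ) (H : SimpleGraph V) (P : VertexPartition V) : Prop :=
  Feasible H P ∧ ∀ Q, Feasible H Q → objective τ H Q ≤ objective τ H P

end VertexPartition

/-- The optimal value `B_{g,f}(H)`. -/
def graphletB {V : Type*} (τ : ℝ) (H : SimpleGraph V) : ℝ :=
  sSup (VertexPartition.objective τ H '' {P | VertexPartition.Feasible H P})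

/-- The supremum in the definition of `graphletB` is a maximum. -/
theorem graphletB_isGreatest {V : Type*} [Finite V] (τ : ℝ) (H : SimpleGraph V) :
    IsGreatest (VertexPartition.objective τ H '' {P | VertexPartition.Feasible H P})
      (graphletB τ H) := by
  have hne : (VertexPartition.objective τ H '' {P | VertexPartition.Feasible H P}).Nonempty :=
    ⟨_, fun _ => 0, fun u hu => by simp [VertexPartition.S₂] at hu, rfl⟩
  have hfin : (VertexPartition.objective τ H '' {P | VertexPartition.Feasible H P}).Finite :=
    (Set.toFinite _).image _
  exact ⟨hne.csSup_mem hfin, fun x hx => le_csSup hfin.bddAbove hx⟩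

end

/-!
Write the hidden variable of `v` as `√(μ n) * exp (x v)`. The probability of inducing `H` on a fixed
set of vertices becomes an integral over the orthant `x v ≥ -L`, with `L` close to `log n / 2`, of
the exponential of a piecewise linear function times a factor for the pairs not joined in `H`, which
vanishes unless `x u + x v ≤ 0` for these pairs. For `|x v| ≤ L`, rounding `x / L` to `-1`, `0` and
`1` at a random threshold turns such a point into a feasible partition, and the average of the
piecewise linear function over the threshold is its value at `x / L`: so its maximum is attained at
a partition. If the optimizer `z` is unique, the function even falls off like
`-c * ∑ v, |x v - L * z v|`, which bounds the integral by its order of magnitude at the optimizer; a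
unit box near `L * z` contributes as much. The vertices can be chosen in about `n ^ k` ways.
-/

noncomputable section

open scoped Topology
open VertexPartition

section Rounding

/-- The rounding of `a` to `1`, `0` or `-1` according to whether `a ≥ θ`, `|a| < θ` or `a ≤ -θ`,
for a threshold `θ > 0`. Its integral over the thresholds recovers `a`, which makes it possible to
write a vector as an average of the exponents of vertex partitions. -/
def thresholdSign (θ a : ℝ) : ℝ := (if θ ≤ a then 1 else 0) - (if θ ≤ -a then 1 else 0)

theorem integral_ite_le {a L : ℝ} (hL : 0 ≤ L) (ha : a ≤ L) :
    ∫ θ in (0 : ℝ)..L, (if θ ≤ a then (1 : ℝ) else 0) = max a 0 := by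
  have hind : (fun θ : ℝ => if θ ≤ a then (1 : ℝ) else 0) = (Set.Iic a).indicator 1 := by
    ext θ
    simp [Set.indicator_apply]
  rw [intervalIntegral.integral_of_le hL, hind, integral_indicator_one measurableSet_Iic,
    measureReal_restrict_apply measurableSet_Iic, Set.inter_comm, Set.Ioc_inter_Iic,
    min_eq_right ha]
  simp [Measure.real, ENNReal.toReal_ofReal']

theorem intervalIntegrable_ite_le (a b c : ℝ) :
    IntervalIntegrable (fun θ : ℝ => if θ ≤ a then (1 : ℝ) else 0) volume b c :=
  AntitoneOn.intervalIntegrable fun x _ y _ hxy => by split_ifs <;> linarith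

theorem intervalIntegrable_thresholdSign (a b c : ℝ) :
    IntervalIntegrable (fun θ => thresholdSign θ a) volume b c :=
  (intervalIntegrable_ite_le _ _ _).sub (intervalIntegrable_ite_le _ _ _)

theorem integral_thresholdSign {a L : ℝ} (ha : |a| ≤ L) :
    ∫ θ in (0 : ℝ)..L, thresholdSign θ a = a := by
  have hL : 0 ≤ L := (abs_nonneg a).trans ha
  simp only [thresholdSign]
  rw [intervalIntegral.integral_sub (intervalIntegrable_ite_le _ _ _)
    (intervalIntegrable_ite_le _ _ _), integral_ite_le hL (le_of_abs_le ha),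
    integral_ite_le hL (neg_le.1 (neg_le_of_abs_le ha))]
  exact max_zero_sub_max_neg_zero_eq_self a

theorem thresholdSign_add_nonpos {θ a b : ℝ} (hθ : 0 < θ) (h : a + b ≤ 0) :
    thresholdSign θ a + thresholdSign θ b ≤ 0 := by
  unfold thresholdSign
  grind

/-- The sum of the roundings of `a` and `b` never has the sign opposite to that of `a + b`, so that
`min (· + ·) 0` is linear along the roundings at all thresholds. -/
theorem min_thresholdSign_add {θ : ℝ} (hθ : 0 < θ) (a b : ℝ) :
    min (thresholdSign θ a + thresholdSign θ b) 0 =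
      if a + b ≤ 0 then thresholdSign θ a + thresholdSign θ b else 0 := by
  unfold thresholdSign
  grind

theorem intervalIntegrable_min_thresholdSign_add (a b c d : ℝ) :
    IntervalIntegrable (fun θ => min (thresholdSign θ a + thresholdSign θ b) 0) volume c d := by
  have h := (intervalIntegrable_thresholdSign a c d).add (intervalIntegrable_thresholdSign b c d)
  exact ⟨h.1.inf (integrable_zero _ _ _), h.2.inf (integrable_zero _ _ _)⟩

theorem integral_min_thresholdSign_add {a b L : ℝ} (ha : |a| ≤ L) (hb : |b| ≤ L) :
    ∫ θ in (0 : ℝ)..L, min (thresholdSign θ a + thresholdSign θ b) 0 = min (a + b) 0 := by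
  have hL : 0 ≤ L := (abs_nonneg a).trans ha
  rw [intervalIntegral.integral_congr_Ioo_of_le hL
    fun θ hθ => min_thresholdSign_add hθ.1 a b]
  split_ifs with h
  · rw [intervalIntegral.integral_add (intervalIntegrable_thresholdSign _ _ _)
      (intervalIntegrable_thresholdSign _ _ _), integral_thresholdSign ha,
      integral_thresholdSign hb, min_eq_left h]
  · rw [intervalIntegral.integral_zero, min_eq_right (not_le.1 h).le]

theorem intervalIntegrable_edge_thresholdSign {V : Type*} (e : Sym2 V) (x : V → ℝ) (a b : ℝ) :
    IntervalIntegrable (fun θ => min (e.map fun v => thresholdSign θ (x v)).add 0) volume a b := by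
  induction e with | _ u v
  exact intervalIntegrable_min_thresholdSign_add _ _ _ _

theorem abs_sub_mul_le_integral_abs_thresholdSign_sub {a L : ℝ} (ha : |a| ≤ L) (z : ℝ) :
    |a - L * z| ≤ ∫ θ in (0 : ℝ)..L, |thresholdSign θ a - z| := by
  have hL : 0 ≤ L := (abs_nonneg a).trans ha
  calc |a - L * z| = |∫ θ in (0 : ℝ)..L, (thresholdSign θ a - z)| := by
        rw [intervalIntegral.integral_sub (intervalIntegrable_thresholdSign _ _ _) (by simp),
          integral_thresholdSign ha]
        simp
    _ ≤ _ := intervalIntegral.abs_integral_le_integral_abs hL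

end Rounding

section Optimization

namespace VertexPartition

variable {V : Type*}

/-- The exponent of a vertex: `-1` on `S₁`, `1` on `S₂` and `0` on `S₃`. In the copies of `H` that
dominate the count, the hidden variable of `v` is of order `n ^ ((1 + exponent P v) / 2)`. -/
def exponent (P : VertexPartition V) (v : V) : ℝ := ![-1, 1, 0] (P v)

theorem exponent_cases (P : VertexPartition V) (v : V) :
    P v = 0 ∧ exponent P v = -1 ∨ P v = 1 ∧ exponent P v = 1 ∨ P v = 2 ∧ exponent P v = 0 := by
  unfold exponent
  generalize P v = a
  fin_cases a <;> simp

/-- The partition that rounds a vector at the threshold `θ`. -/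
def ofThreshold (θ : ℝ) (x : V → ℝ) : VertexPartition V :=
  fun v => if θ ≤ -x v then 0 else if θ ≤ x v then 1 else 2

theorem exponent_ofThreshold {θ : ℝ} (hθ : 0 < θ) (x : V → ℝ) (v : V) :
    exponent (ofThreshold θ x) v = thresholdSign θ (x v) := by
  unfold exponent ofThreshold thresholdSign
  split_ifs <;> first | (exfalso; linarith) | simp

theorem feasible_iff {H : SimpleGraph V} {P : VertexPartition V} :
    Feasible H P ↔ ∀ u v, u ≠ v → ¬ H.Adj u v → exponent P u + exponent P v ≤ 0 := by
  have hlabel : ∀ a b : Fin 3, (![-1, 1, 0] a + ![-1, 1, 0] b : ℝ) ≤ 0 ↔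
      ¬ (a = 1 ∧ (b = 1 ∨ b = 2)) ∧ ¬ (b = 1 ∧ (a = 1 ∨ a = 2)) := by
    intro a b
    fin_cases a <;> fin_cases b <;> simp
  simp only [exponent, hlabel, Feasible, S₂, S₃, Set.mem_ofPred_eq, Set.mem_union]
  constructor
  · intro h u v huv hadj
    exact ⟨fun ⟨hu, hv⟩ => hadj (h u hu v hv huv),
      fun ⟨hv, hu⟩ => hadj (h v hv u hu huv.symm).symm⟩
  · intro h u hu v hv huv
    by_contra hadj
    exact (h u v huv hadj).1 ⟨hu, hv⟩

theorem feasible_ofThreshold {H : SimpleGraph V} {θ : ℝ} (hθ : 0 < θ) {x : V → ℝ}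
    (hx : ∀ u v, u ≠ v → ¬ H.Adj u v → x u + x v ≤ 0) : Feasible H (ofThreshold θ x) := by
  refine feasible_iff.2 fun u v huv hadj => ?_
  simpa only [exponent_ofThreshold hθ] using thresholdSign_add_nonpos hθ (hx u v huv hadj)

/-- The box starts at the dilated optimizer, with the vertices outside `S₁` moved down by `3`: this
keeps the connection probabilities of the pairs that are not joined in `H` away from `1`. -/
theorem Feasible.exists_box {H : SimpleGraph V} {P : VertexPartition V} (hP : Feasible H P) {L : ℝ}
    (hL : 3 ≤ L) : ∃ a : V → ℝ, ∀ x ∈ Set.Icc a (a + 1),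
      (∀ v, -L ≤ x v) ∧ (∀ u v, u ≠ v → ¬ H.Adj u v → x u + x v ≤ -1) ∧
        ∀ v, |x v - L * exponent P v| ≤ 3 := by
  refine ⟨fun v => L * exponent P v - if P v = 0 then 0 else 3, fun x hx => ?_⟩
  have hbox (v : V) : P v = 0 ∧ x v ∈ Set.Icc (-L) (-L + 1) ∨
      P v = 1 ∧ x v ∈ Set.Icc (L - 3) (L - 2) ∨ P v = 2 ∧ x v ∈ Set.Icc (-3) (-2) := by
    have hlow := hx.1 v
    have hup := hx.2 v
    simp only [Pi.add_apply, Pi.one_apply] at hlow hup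
    rcases exponent_cases P v with ⟨h, he⟩ | ⟨h, he⟩ | ⟨h, he⟩ <;> rw [he] at hlow hup <;> grind
  refine ⟨fun v => ?_, fun u v huv hadj => ?_, fun v => ?_⟩
  · rcases hbox v with h | h | h <;> linarith [h.2.1]
  · have hu : P u = 1 → P v ≠ 1 ∧ P v ≠ 2 := fun hu =>
      not_or.1 fun hv => hadj (hP u hu v hv huv)
    have hv : P v = 1 → P u ≠ 2 := fun hv hu => hadj (hP v hv u (.inr hu) huv.symm).symm
    grind
  · rcases exponent_cases P v with ⟨h, he⟩ | ⟨h, he⟩ | ⟨h, he⟩ <;> rw [he] <;> grind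

end VertexPartition

variable {V : Type*} [Fintype V] {H : SimpleGraph V} {τ : ℝ}

open scoped Classical in
/-- The exponent of the contribution to the expected number of copies of `H` that comes from hidden
variables `√(μ n) * exp (x v)`, for `v ∈ V`: every edge contributes the logarithm of its
probability, every vertex the logarithm of the Pareto tail. -/
def logWeight (τ : ℝ) (H : SimpleGraph V) (x : V → ℝ) : ℝ :=
  ∑ e ∈ H.edgeFinset, min (e.map x).add 0 - (τ - 1) * ∑ v, x v

theorem logWeight_exponent (hτ : 1 < τ) (H : SimpleGraph V) (P : VertexPartition V) :
    logWeight τ H (exponent P) = (τ - 1) * objective τ H P := by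
  classical
  have hvert : ∑ v, exponent P v = ((S₂ P).ncard : ℝ) - (S₁ P).ncard := by
    simp only [S₁, S₂, Set.ncard_eq_toFinset_card', Set.toFinset_ofPred, Finset.cast_card,
      Finset.sum_filter, ← Finset.sum_sub_distrib]
    refine Finset.sum_congr rfl fun v _ => ?_
    unfold exponent
    generalize P v = a
    fin_cases a <;> simp
  have hedge (p : Sym2 V → Prop) :
      ({e ∈ H.edgeSet | p e}.ncard : ℝ) = ∑ e ∈ H.edgeFinset, if p e then 1 else 0 := by
    rw [Set.ncard_eq_toFinset_card', Finset.sum_boole]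
    congr 2
    ext e
    simp
  have hedges : ∑ e ∈ H.edgeFinset, min (e.map (exponent P)).add 0 =
      -(2 * (edgesInS₁ H P : ℝ) + edgesS₁S₃ H P) := by
    rw [edgesInS₁, edgesS₁S₃, hedge, hedge, Finset.mul_sum, ← Finset.sum_add_distrib,
      ← Finset.sum_neg_distrib]
    refine Finset.sum_congr rfl fun e _ => ?_
    induction e with | _ u v
    simp only [Sym2.map_mk, Sym2.add_mk, exponent, S₁, S₃, Sym2.mem_iff, Set.mem_ofPred_eq,
      forall_eq_or_imp, forall_eq, exists_eq_or_imp, exists_eq_left]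
    generalize P u = a
    generalize P v = b
    fin_cases a <;> fin_cases b <;> norm_num [Fin.ext_iff]
  have hτ' : τ - 1 ≠ 0 := by linarith
  rw [logWeight, hvert, hedges, objective]
  field_simp
  ring

theorem logWeight_smul {L : ℝ} (hL : 0 ≤ L) (x : V → ℝ) :
    logWeight τ H (L • x) = L * logWeight τ H x := by
  have hmin (e : Sym2 V) : min (e.map (L • x)).add 0 = L * min (e.map x).add 0 := by
    induction e with | _ u v
    simp [mul_min_of_nonneg _ _ hL, mul_add]
  simp only [logWeight, hmin]
  simp only [Pi.smul_apply, smul_eq_mul, ← Finset.mul_sum]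
  ring

theorem integral_logWeight_thresholdSign {L : ℝ} {x : V → ℝ} (hx : ∀ v, |x v| ≤ L) :
    IntervalIntegrable (fun θ => logWeight τ H fun v => thresholdSign θ (x v)) volume 0 L ∧
    ∫ θ in (0 : ℝ)..L, logWeight τ H (fun v => thresholdSign θ (x v)) = logWeight τ H x := by
  classical
  have hmin_eq (e : Sym2 V) :
      ∫ θ in (0 : ℝ)..L, min (e.map fun v => thresholdSign θ (x v)).add 0 =
        min (e.map x).add 0 := by
    induction e with | _ u v
    exact integral_min_thresholdSign_add (hx u) (hx v)
  have hedges : IntervalIntegrable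
      (fun θ => ∑ e ∈ H.edgeFinset, min (e.map fun v => thresholdSign θ (x v)).add 0)
      volume 0 L := by
    simpa only [Finset.sum_fn] using
      IntervalIntegrable.sum H.edgeFinset fun e _ => intervalIntegrable_edge_thresholdSign e x 0 L
  have hverts : IntervalIntegrable (fun θ => ∑ v, thresholdSign θ (x v)) volume 0 L := by
    simpa only [Finset.sum_fn] using
      IntervalIntegrable.sum Finset.univ fun v _ => intervalIntegrable_thresholdSign (x v) 0 L
  unfold logWeight
  refine ⟨hedges.sub (hverts.const_mul (τ - 1)), ?_⟩
  rw [intervalIntegral.integral_sub hedges (hverts.const_mul _),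
    intervalIntegral.integral_const_mul, intervalIntegral.integral_finsetSum,
    intervalIntegral.integral_finsetSum]
  · simp only [hmin_eq, integral_thresholdSign (hx _)]
  · exact fun v _ => intervalIntegrable_thresholdSign (x v) 0 L
  · exact fun e _ => intervalIntegrable_edge_thresholdSign e x 0 L

theorem eventually_forall_add_mul_le {ι : Type*} [Finite ι] {f d : ι → ℝ} {M : ℝ}
    (h : ∀ i, f i < M ∨ f i = M ∧ d i = 0) : ∀ᶠ c in 𝓝[>] 0, ∀ i, f i + c * d i ≤ M := by
  refine eventually_all.2 fun i => ?_
  obtain hlt | ⟨heq, hzero⟩ := h i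
  · have hcont : Tendsto (fun c => f i + c * d i) (𝓝 0) (𝓝 (f i)) := by
      simpa using (by fun_prop : Continuous fun c : ℝ => f i + c * d i).tendsto 0
    exact nhdsWithin_le_nhds ((hcont.eventually_lt_const hlt).mono fun _ => le_of_lt)
  · exact .of_forall fun c => by simp [heq, hzero]

theorem exists_logWeight_exponent_gap (hτ : 1 < τ) {P : VertexPartition V}
    (hP : IsOptimizer τ H P) (hunique : ∀ Q, IsOptimizer τ H Q → Q = P) :
    ∃ c, 0 < c ∧ c < τ - 1 ∧ ∀ Q, Feasible H Q →
      logWeight τ H (exponent Q) + c * ∑ v, |exponent Q v - exponent P v| ≤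
        logWeight τ H (exponent P) := by
  have hτ' : 0 < τ - 1 := sub_pos.2 hτ
  have hgap : ∀ Q : {Q // Feasible H Q},
      logWeight τ H (exponent Q) < logWeight τ H (exponent P) ∨
        logWeight τ H (exponent Q) = logWeight τ H (exponent P) ∧
          ∑ v, |exponent Q.1 v - exponent P v| = 0 := by
    rintro ⟨Q, hQ⟩
    rw [logWeight_exponent hτ, logWeight_exponent hτ, mul_lt_mul_iff_right₀ hτ']
    refine (hP.2 Q hQ).lt_or_eq.imp_right fun heq => ?_
    obtain rfl := hunique Q ⟨hQ, fun R hR => (hP.2 R hR).trans_eq heq.symm⟩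
    simp
  obtain ⟨c, hc, hcτ, hcpos⟩ := ((eventually_forall_add_mul_le hgap).and
    (Ioo_mem_nhdsGT hτ')).exists
  exact ⟨c, hcτ, hcpos, fun Q hQ => hc ⟨Q, hQ⟩⟩

/-- The bound holds at the roundings of `x`, which are exponents of feasible partitions, and is
averaged over the threshold. -/
theorem logWeight_add_le_of_abs_le {c L M : ℝ} {x z : V → ℝ} (hc : 0 ≤ c) (hL : 0 ≤ L)
    (hM : ∀ Q, Feasible H Q → logWeight τ H (exponent Q) + c * ∑ v, |exponent Q v - z v| ≤ M)
    (hxL : ∀ v, |x v| ≤ L) (hx : ∀ u v, u ≠ v → ¬ H.Adj u v → x u + x v ≤ 0) :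
    logWeight τ H x + c * ∑ v, |x v - L * z v| ≤ L * M := by
  obtain ⟨hinteg, hintegral⟩ := integral_logWeight_thresholdSign (τ := τ) (H := H) hxL
  have habs (v : V) : IntervalIntegrable (fun θ => |thresholdSign θ (x v) - z v|) volume 0 L :=
    ((intervalIntegrable_thresholdSign (x v) 0 L).sub intervalIntegrable_const).abs
  have hsum : IntervalIntegrable (fun θ => ∑ v, |thresholdSign θ (x v) - z v|) volume 0 L := by
    simpa only [Finset.sum_fn] using IntervalIntegrable.sum Finset.univ fun v _ => habs v
  calc logWeight τ H x + c * ∑ v, |x v - L * z v|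
      ≤ logWeight τ H x + c * ∑ v, ∫ θ in (0 : ℝ)..L, |thresholdSign θ (x v) - z v| := by
        gcongr with v
        exact abs_sub_mul_le_integral_abs_thresholdSign_sub (hxL v) (z v)
    _ = ∫ θ in (0 : ℝ)..L, (logWeight τ H (fun v => thresholdSign θ (x v)) +
          c * ∑ v, |thresholdSign θ (x v) - z v|) := by
        rw [intervalIntegral.integral_add hinteg (hsum.const_mul c), hintegral,
          intervalIntegral.integral_const_mul,
          intervalIntegral.integral_finsetSum fun v _ => habs v]
    _ ≤ ∫ _ in (0 : ℝ)..L, M := by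
        refine intervalIntegral.integral_mono_on_of_le_Ioo hL (hinteg.add (hsum.const_mul c))
          intervalIntegrable_const fun θ hθ => ?_
        simpa only [exponent_ofThreshold hθ.1, funext fun v => exponent_ofThreshold hθ.1 x v]
          using hM _ (feasible_ofThreshold hθ.1 hx)
    _ = L * M := by simp

theorem logWeight_eq_logWeight_min_sub {L : ℝ} {x : V → ℝ} (hL : 0 ≤ L) (hx : ∀ v, -L ≤ x v) :
    logWeight τ H x =
      logWeight τ H (fun v => min (x v) L) - (τ - 1) * ∑ v, (x v - min (x v) L) := by
  have hmin (e : Sym2 V) :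
      min (e.map x).add 0 = min (e.map fun v => min (x v) L).add 0 := by
    induction e with | _ u v
    have hu := hx u
    have hv := hx v
    simp only [Sym2.map_mk, Sym2.add_mk]
    grind
  simp only [logWeight, hmin, Finset.sum_sub_distrib]
  ring

theorem logWeight_add_le {c L M : ℝ} {x z : V → ℝ} (hc : 0 ≤ c) (hcτ : c ≤ τ - 1) (hL : 0 ≤ L)
    (hM : ∀ Q, Feasible H Q → logWeight τ H (exponent Q) + c * ∑ v, |exponent Q v - z v| ≤ M)
    (hxL : ∀ v, -L ≤ x v) (hx : ∀ u v, u ≠ v → ¬ H.Adj u v → x u + x v ≤ 0) :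
    logWeight τ H x + c * ∑ v, |x v - L * z v| ≤ L * M := by
  have htrunc : logWeight τ H (fun v => min (x v) L) + c * ∑ v, |min (x v) L - L * z v| ≤ L * M :=
    logWeight_add_le_of_abs_le hc hL hM
      (fun v => abs_le.2 ⟨le_min (hxL v) (by linarith), min_le_right _ _⟩)
      fun u v huv hadj => (add_le_add (min_le_left _ _) (min_le_left _ _)).trans (hx u v huv hadj)
  have habs : ∑ v, |x v - L * z v| ≤
      ∑ v, |min (x v) L - L * z v| + ∑ v, (x v - min (x v) L) := by
    rw [← Finset.sum_add_distrib]
    refine Finset.sum_le_sum fun v _ => ?_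
    have hle : min (x v) L ≤ x v := min_le_left _ _
    grind
  have hnonneg : 0 ≤ ∑ v, (x v - min (x v) L) :=
    Finset.sum_nonneg fun v _ => sub_nonneg.2 (min_le_left _ _)
  rw [logWeight_eq_logWeight_min_sub hL hxL]
  nlinarith [mul_le_mul_of_nonneg_left habs hc, mul_le_mul_of_nonneg_right hcτ hnonneg]

theorem logWeight_sub_le_logWeight {δ : ℝ} (hτ : 1 ≤ τ) {x y : V → ℝ}
    (hxy : ∀ v, |x v - y v| ≤ δ) :
    logWeight τ H y - (2 * H.edgeSet.ncard + (τ - 1) * Fintype.card V) * δ ≤ logWeight τ H x := by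
  classical
  have hedges : ∑ e ∈ H.edgeFinset, (min (e.map y).add 0 - 2 * δ) ≤
      ∑ e ∈ H.edgeFinset, min (e.map x).add 0 := by
    refine Finset.sum_le_sum fun e _ => ?_
    induction e with | _ u v
    have hu := hxy u
    have hv := hxy v
    simp only [Sym2.map_mk, Sym2.add_mk]
    grind
  have hverts : ∑ v, x v ≤ ∑ v, (y v + δ) :=
    Finset.sum_le_sum fun v _ => by linarith [(abs_le.1 (hxy v)).2]
  have hcard : H.edgeSet.ncard = H.edgeFinset.card := by
    rw [Set.ncard_eq_toFinset_card', SimpleGraph.edgeFinset]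
  simp only [Finset.sum_sub_distrib, Finset.sum_add_distrib, Finset.sum_const, nsmul_eq_mul,
    Finset.card_univ] at hedges hverts
  simp only [logWeight]
  rw [hcard]
  nlinarith [mul_le_mul_of_nonneg_left hverts (sub_nonneg.2 hτ)]

end Optimization

section ProductMeasure

theorem lmarginal_prod_eq_prod_lintegral {ι : Type*} [DecidableEq ι] {X : ι → Type*}
    [∀ i, MeasurableSpace (X i)] {μ : ∀ i, Measure (X i)} [∀ i, SigmaFinite (μ i)]
    {f : ∀ i, X i → ENNReal} (hf : ∀ i, Measurable (f i)) (s : Finset ι) :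
    (∫⋯∫⁻_s, (fun x => ∏ i ∈ s, f i (x i)) ∂μ) = fun _ => ∏ i ∈ s, ∫⁻ x, f i x ∂μ i := by
  induction s using Finset.induction with
  | empty => simp
  | insert i s hi ih =>
    have hmeas : Measurable fun x : ∀ i, X i => ∏ j ∈ s, f j (x j) := by fun_prop
    have hupdate (x : ∀ i, X i) (xi : X i) : ∏ j ∈ insert i s, f j (Function.update x i xi j) =
        f i xi * ∏ j ∈ s, f j (x j) := by
      rw [Finset.prod_insert hi, Function.update_self]
      congr 1
      exact Finset.prod_congr rfl fun j hj => by
        rw [Function.update_of_ne (ne_of_mem_of_not_mem hj hi)]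
    rw [lmarginal_insert' _ (by fun_prop) hi]
    simp only [hupdate, lintegral_mul_const _ (hf i)]
    ext x
    have hs := congrFun ih x
    simp only [lmarginal] at hs ⊢
    rw [lintegral_const_mul _ (by exact hmeas.comp measurable_updateFinset), hs,
      Finset.prod_insert hi]

variable {ι : Type*} [Fintype ι] {X : ι → Type*} [∀ i, MeasurableSpace (X i)]

theorem lintegral_fintype_prod_eq_prod {μ : ∀ i, Measure (X i)} [∀ i, SigmaFinite (μ i)]
    {f : ∀ i, X i → ENNReal} (hf : ∀ i, Measurable (f i)) :
    ∫⁻ x, ∏ i, f i (x i) ∂Measure.pi μ = ∏ i, ∫⁻ x, f i x ∂μ i := by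
  classical
  obtain hX | ⟨⟨x⟩⟩ := isEmpty_or_nonempty (∀ i, X i)
  · obtain ⟨i, hi⟩ := isEmpty_pi.1 hX
    rw [lintegral_of_isEmpty, Finset.prod_eq_zero (Finset.mem_univ i) (lintegral_of_isEmpty _ _)]
  · rw [lintegral_eq_lmarginal_univ x, lmarginal_prod_eq_prod_lintegral hf]

theorem pi_withDensity {μ : ∀ i, Measure (X i)} [∀ i, SigmaFinite (μ i)]
    {f : ∀ i, X i → ENNReal} (hf : ∀ i, Measurable (f i))
    [∀ i, SigmaFinite ((μ i).withDensity (f i))] :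
    Measure.pi (fun i => (μ i).withDensity (f i)) =
      (Measure.pi μ).withDensity fun x => ∏ i, f i (x i) := by
  refine Measure.pi_eq fun s hs => ?_
  rw [withDensity_apply _ (MeasurableSet.univ_pi hs), Measure.restrict_pi_pi,
    lintegral_fintype_prod_eq_prod hf]
  simp only [withDensity_apply _ (hs _)]

theorem lintegral_exp_neg_mul_abs_sub {c : ℝ} (hc : 0 < c) (a : ℝ) :
    ∫⁻ x : ℝ, ENNReal.ofReal (Real.exp (-c * |x - a|)) = ENNReal.ofReal (2 / c) := by
  rw [lintegral_sub_right_eq_self (fun x => ENNReal.ofReal (Real.exp (-c * |x|)))]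
  have hintegral : ∫ x : ℝ, Real.exp (-c * |x|) = 2 / c := by
    rw [integral_comp_abs (f := fun x => Real.exp (-c * x)),
      integral_exp_mul_Ioi (neg_neg_of_pos hc)]
    simp [div_eq_mul_inv]
  have hinteg : Integrable fun x : ℝ => Real.exp (-c * |x|) :=
    not_imp_comm.1 integral_undef (by rw [hintegral]; positivity)
  rw [← ofReal_integral_eq_lintegral_ofReal hinteg (.of_forall fun x => (Real.exp_pos _).le),
    hintegral]

end ProductMeasure

section Integral

variable {V : Type*} [Fintype V] {H : SimpleGraph V} {τ : ℝ}

open scoped Classical in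
/-- The probability that all pairs of distinct vertices that are not joined in `H` stay unjoined
when the hidden variables are `√(μ n) * exp (x v)`, for `v ∈ V`. -/
def nonedgeProb (H : SimpleGraph V) (x : V → ℝ) : ℝ :=
  ∏ e ∈ Hᶜ.edgeFinset, (1 - Real.exp (min (e.map x).add 0))

theorem nonedgeProb_le_one (x : V → ℝ) : nonedgeProb H x ≤ 1 :=
  Finset.prod_le_one (fun _ _ => sub_nonneg.2 (Real.exp_le_one_iff.2 (min_le_right _ _)))
    fun _ _ => sub_le_self _ (Real.exp_pos _).le

theorem nonedgeProb_eq_zero {x : V → ℝ} {u v : V} (huv : u ≠ v) (hadj : ¬ H.Adj u v)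
    (hx : 0 ≤ x u + x v) : nonedgeProb H x = 0 := by
  classical
  refine Finset.prod_eq_zero (i := s(u, v)) ?_ ?_
  · simp [huv, hadj]
  · simp [hx]

theorem le_nonedgeProb {x : V → ℝ} (hx : ∀ u v, u ≠ v → ¬ H.Adj u v → x u + x v ≤ -1) :
    (1 / 2) ^ Hᶜ.edgeSet.ncard ≤ nonedgeProb H x := by
  classical
  have hcard : Hᶜ.edgeSet.ncard = Hᶜ.edgeFinset.card := by
    rw [Set.ncard_eq_toFinset_card', SimpleGraph.edgeFinset]
  rw [hcard, ← Finset.prod_const]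
  refine Finset.prod_le_prod (fun _ _ => by norm_num) fun e he => ?_
  induction e with | _ u v
  rw [SimpleGraph.mem_edgeFinset, SimpleGraph.mem_edgeSet, SimpleGraph.compl_adj] at he
  have hsum := hx u v he.1 he.2
  rw [Sym2.map_mk, Sym2.add_mk, min_eq_left (by linarith)]
  have hexp : Real.exp (x u + x v) ≤ 1 / 2 :=
    calc Real.exp (x u + x v) ≤ Real.exp (-1) := Real.exp_le_exp.2 hsum
      _ ≤ 1 / 2 := by linarith [Real.exp_neg_one_lt_half]
  linarith

/-- The integral that gives the probability of inducing `H` on a fixed set of vertices, in the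
coordinates `x v` for which the hidden variable of `v` is `√(μ n) * exp (x v)`. In these coordinates
the lower bound `hmin` for the hidden variables becomes `-L`. -/
def graphletIntegral (τ : ℝ) (H : SimpleGraph V) (L : ℝ) : ENNReal :=
  ∫⁻ x in Set.Ici (fun _ => -L), ENNReal.ofReal (Real.exp (logWeight τ H x) * nonedgeProb H x)

theorem graphletIntegral_le {c L M : ℝ} {z : V → ℝ} (hc : 0 < c) (hcτ : c ≤ τ - 1) (hL : 0 ≤ L)
    (hM : ∀ Q, Feasible H Q → logWeight τ H (exponent Q) + c * ∑ v, |exponent Q v - z v| ≤ M) :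
    graphletIntegral τ H L ≤
      ENNReal.ofReal ((2 / c) ^ Fintype.card V * Real.exp (L * M)) := by
  have hbound {x : V → ℝ} (hx : x ∈ Set.Ici fun _ => -L) :
      Real.exp (logWeight τ H x) * nonedgeProb H x ≤
        Real.exp (L * M) * ∏ v, Real.exp (-c * |x v - L * z v|) := by
    by_cases hfeas : ∀ u v, u ≠ v → ¬ H.Adj u v → x u + x v ≤ 0
    · calc Real.exp (logWeight τ H x) * nonedgeProb H x ≤ Real.exp (logWeight τ H x) :=
          mul_le_of_le_one_right (Real.exp_pos _).le (nonedgeProb_le_one x)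
        _ ≤ Real.exp (L * M + ∑ v, -c * |x v - L * z v|) := by
          rw [Real.exp_le_exp, ← Finset.mul_sum]
          linarith [logWeight_add_le hc.le hcτ hL hM hx hfeas]
        _ = _ := by rw [Real.exp_add, Real.exp_sum]
    · push Not at hfeas
      obtain ⟨u, v, huv, hadj, hpos⟩ := hfeas
      rw [nonedgeProb_eq_zero huv hadj hpos.le, mul_zero]
      positivity
  calc graphletIntegral τ H L
      ≤ ∫⁻ x in Set.Ici (fun _ : V => -L),
          ENNReal.ofReal (Real.exp (L * M) * ∏ v, Real.exp (-c * |x v - L * z v|)) :=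
        setLIntegral_mono' measurableSet_Ici fun x hx => ENNReal.ofReal_le_ofReal (hbound hx)
    _ ≤ ∫⁻ x : V → ℝ, ENNReal.ofReal (Real.exp (L * M) * ∏ v, Real.exp (-c * |x v - L * z v|)) :=
        setLIntegral_le_lintegral _ _
    _ = ENNReal.ofReal (Real.exp (L * M)) *
          ∫⁻ x : V → ℝ, ∏ v, ENNReal.ofReal (Real.exp (-c * |x v - L * z v|)) := by
        rw [← lintegral_const_mul _ (by fun_prop)]
        congr! 2 with x
        rw [ENNReal.ofReal_mul (Real.exp_pos _).le,
          ENNReal.ofReal_prod_of_nonneg fun _ _ => (Real.exp_pos _).le]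
    _ = ENNReal.ofReal ((2 / c) ^ Fintype.card V * Real.exp (L * M)) := by
        rw [volume_pi, lintegral_fintype_prod_eq_prod
          (f := fun v x => ENNReal.ofReal (Real.exp (-c * |x - L * z v|))) fun v => by fun_prop]
        simp only [lintegral_exp_neg_mul_abs_sub hc, Finset.prod_const, Finset.card_univ]
        rw [← ENNReal.ofReal_pow (by positivity), ← ENNReal.ofReal_mul (Real.exp_pos _).le,
          mul_comm]

theorem le_graphletIntegral {P : VertexPartition V} (hτ : 1 ≤ τ) (hP : Feasible H P) {L : ℝ}
    (hL : 3 ≤ L) :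
    ENNReal.ofReal ((1 / 2) ^ Hᶜ.edgeSet.ncard *
        Real.exp (-((2 * H.edgeSet.ncard + (τ - 1) * Fintype.card V) * 3)) *
          Real.exp (L * logWeight τ H (exponent P))) ≤ graphletIntegral τ H L := by
  obtain ⟨a, ha⟩ := hP.exists_box hL
  have hbound {x : V → ℝ} (hx : x ∈ Set.Icc a (a + 1)) :
      (1 / 2) ^ Hᶜ.edgeSet.ncard *
        Real.exp (-((2 * H.edgeSet.ncard + (τ - 1) * Fintype.card V) * 3)) *
          Real.exp (L * logWeight τ H (exponent P)) ≤
        Real.exp (logWeight τ H x) * nonedgeProb H x := by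
    obtain ⟨-, hnonadj, hdist⟩ := ha x hx
    have hweight := logWeight_sub_le_logWeight (H := H) hτ (y := L • exponent P) hdist
    rw [logWeight_smul (by linarith)] at hweight
    rw [mul_assoc, ← Real.exp_add, mul_comm]
    gcongr
    · linarith
    · exact le_nonedgeProb hnonadj
  have hvol : volume (Set.Icc a (a + 1)) = 1 := by simp [Real.volume_Icc_pi]
  calc _ = ∫⁻ _ in Set.Icc a (a + 1), ENNReal.ofReal ((1 / 2) ^ Hᶜ.edgeSet.ncard *
        Real.exp (-((2 * H.edgeSet.ncard + (τ - 1) * Fintype.card V) * 3)) *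
          Real.exp (L * logWeight τ H (exponent P))) := by rw [setLIntegral_const, hvol, mul_one]
    _ ≤ ∫⁻ x in Set.Icc a (a + 1),
          ENNReal.ofReal (Real.exp (logWeight τ H x) * nonedgeProb H x) :=
        setLIntegral_mono' measurableSet_Icc fun x hx => ENNReal.ofReal_le_ofReal (hbound hx)
    _ ≤ graphletIntegral τ H L := lintegral_mono_set fun x hx => (ha x hx).1

theorem isTheta_graphletIntegral (hτ : 1 < τ) {P : VertexPartition V} (hP : IsOptimizer τ H P)
    (hunique : ∀ Q, IsOptimizer τ H Q → Q = P) :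
    (fun L => (graphletIntegral τ H L).toReal) =Θ[atTop]
      fun L => Real.exp (L * ((τ - 1) * objective τ H P)) := by
  obtain ⟨c, hc, hcτ, hgap⟩ := exists_logWeight_exponent_gap hτ hP hunique
  rw [← logWeight_exponent hτ]
  have hupper {L : ℝ} (hL : 0 ≤ L) := graphletIntegral_le hc hcτ.le hL hgap
  constructor
  · refine .of_bound ((2 / c) ^ Fintype.card V) ?_
    filter_upwards [eventually_ge_atTop 0] with L hL
    rw [Real.norm_of_nonneg ENNReal.toReal_nonneg, Real.norm_of_nonneg (Real.exp_pos _).le]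
    exact ENNReal.toReal_le_of_le_ofReal (by positivity) (hupper hL)
  · refine isBigO_iff''.2 ⟨(1 / 2) ^ Hᶜ.edgeSet.ncard *
      Real.exp (-((2 * H.edgeSet.ncard + (τ - 1) * Fintype.card V) * 3)), by positivity, ?_⟩
    filter_upwards [eventually_ge_atTop 3] with L hL
    rw [Real.norm_of_nonneg ENNReal.toReal_nonneg, Real.norm_of_nonneg (Real.exp_pos _).le]
    exact (ENNReal.ofReal_le_iff_le_toReal
      ((hupper (zero_le_three.trans hL)).trans_lt ENNReal.ofReal_lt_top).ne).1
      (le_graphletIntegral hτ.le hP.1 hL)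

end Integral

section Pareto

variable {t : ℝ}

theorem image_mul_exp_add_Ici (ht : 0 < t) (L : ℝ) :
    (fun x => t * Real.exp (L + x)) '' Set.Ici (-L) = Set.Ici t := by
  ext h
  simp only [Set.mem_image, Set.mem_Ici]
  constructor
  · rintro ⟨x, hx, rfl⟩
    exact le_mul_of_one_le_right ht.le (Real.one_le_exp (by linarith))
  · intro hh
    have hpos : 0 < h / t := div_pos (ht.trans_le hh) ht
    have hlog : 0 ≤ Real.log (h / t) := Real.log_nonneg ((one_le_div ht).2 hh)
    refine ⟨Real.log (h / t) - L, by linarith, ?_⟩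
    rw [add_sub_cancel, Real.exp_log hpos, mul_div_cancel₀ _ ht.ne']

theorem paretoMeasure_eq_map (ht : 0 < t) (r L : ℝ) :
    paretoMeasure t r = ((volume.restrict (Set.Ici (-L))).withDensity fun x =>
      ENNReal.ofReal (r * Real.exp (-r * (L + x)))).map fun x => t * Real.exp (L + x) := by
  have hderiv (x : ℝ) : HasDerivAt (fun x => t * Real.exp (L + x)) (t * Real.exp (L + x)) x := by
    simpa using (((hasDerivAt_id x).const_add L).exp.const_mul t)
  have hinj : Function.Injective fun x => t * Real.exp (L + x) := fun x y hxy => by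
    simpa [ht.ne'] using hxy
  have hdensity (x : ℝ) : ENNReal.ofReal |t * Real.exp (L + x)| *
      ENNReal.ofReal (r * t ^ r * (t * Real.exp (L + x)) ^ (-(r + 1))) =
      ENNReal.ofReal (r * Real.exp (-r * (L + x))) := by
    have hpos : 0 < t * Real.exp (L + x) := by positivity
    rw [abs_of_pos hpos, ← ENNReal.ofReal_mul hpos.le, neg_add, Real.rpow_add hpos,
      Real.rpow_neg_one, Real.mul_rpow ht.le (Real.exp_pos _).le, Real.rpow_neg ht.le,
      ← Real.exp_mul, mul_comm (L + x)]
    congr 1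
    field_simp
  have hpdf : paretoPDF t r = (Set.Ici t).indicator fun h =>
      ENNReal.ofReal (r * t ^ r * h ^ (-(r + 1))) := by
    ext h
    by_cases hh : t ≤ h
    · rw [paretoPDF_of_le hh, Set.indicator_of_mem (Set.mem_Ici.2 hh)]
    · rw [paretoPDF_of_lt (not_le.1 hh), Set.indicator_of_notMem (by simpa using hh)]
  ext s hs
  have hpre : MeasurableSet ((fun x => t * Real.exp (L + x)) ⁻¹' s) :=
    (by fun_prop : Measurable fun x => t * Real.exp (L + x)) hs
  rw [Measure.map_apply (by fun_prop) hs, withDensity_apply _ hpre, paretoMeasure,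
    withDensity_apply _ hs, hpdf, setLIntegral_indicator measurableSet_Ici, Set.inter_comm,
    ← image_mul_exp_add_Ici ht L, ← Set.image_preimage_inter, Measure.restrict_restrict hpre,
    lintegral_image_eq_lintegral_abs_deriv_mul (hpre.inter measurableSet_Ici)
      (fun x _ => (hderiv x).hasDerivWithinAt) hinj.injOn]
  simp only [hdensity]

theorem lintegral_pi_paretoMeasure {ι : Type*} [Fintype ι] (ht : 0 < t) {r : ℝ} (hr : 0 < r)
    (L : ℝ) {F : (ι → ℝ) → ENNReal} (hF : Measurable F) :
    ∫⁻ h, F h ∂Measure.pi (fun _ => paretoMeasure t r) =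
      ∫⁻ x in Set.Ici (fun _ => -L),
        (∏ i, ENNReal.ofReal (r * Real.exp (-r * (L + x i)))) *
          F fun i => t * Real.exp (L + x i) := by
  set ν := (volume.restrict (Set.Ici (-L))).withDensity fun x =>
    ENNReal.ofReal (r * Real.exp (-r * (L + x)))
  have hmap : paretoMeasure t r = ν.map fun x => t * Real.exp (L + x) :=
    paretoMeasure_eq_map ht r L
  have hprob : IsProbabilityMeasure (ν.map fun x => t * Real.exp (L + x)) :=
    hmap ▸ isProbabilityMeasure_paretoMeasure ht hr
  have hν : IsProbabilityMeasure ν :=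
    Measure.isProbabilityMeasure_of_map fun x => t * Real.exp (L + x)
  have hpi : Measure.pi (fun _ : ι => ν) = (volume.restrict (Set.Ici fun _ => -L)).withDensity
      fun x => ∏ i, ENNReal.ofReal (r * Real.exp (-r * (L + x i))) := by
    have hrestrict : Measure.pi (fun _ : ι => (volume : Measure ℝ).restrict (Set.Ici (-L))) =
        volume.restrict (Set.Ici fun _ => -L) := by
      rw [← Set.pi_univ_Ici, volume_pi, Measure.restrict_pi_pi]
    rw [← hrestrict]
    exact pi_withDensity (fun _ => by fun_prop)
  rw [hmap, ← Measure.pi_map_pi fun _ => by fun_prop, lintegral_map hF (by fun_prop), hpi,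
    lintegral_withDensity_eq_lintegral_mul _ (by fun_prop) (by fun_prop)]
  rfl

theorem ae_paretoMeasure_ge (t r : ℝ) : ∀ᵐ h ∂(paretoMeasure t r), t ≤ h := by
  simp only [ae_iff, not_le]
  exact (withDensity_apply _ measurableSet_Iio).trans (lintegral_paretoPDF_of_le le_rfl)

theorem integrable_id_paretoMeasure {r : ℝ} (ht : 0 < t) (hr : 1 < r) :
    Integrable (fun h : ℝ => h) (paretoMeasure t r) := by
  have hm : Measurable (paretoPDF t r) := (measurable_paretoPDFReal t r).ennreal_ofReal
  rw [paretoMeasure, integrable_withDensity_iff hm (by simp [paretoPDF])]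
  have hinteg : IntegrableOn (fun h : ℝ => r * t ^ r * h ^ (-r)) (Set.Ici t) := by
    rw [integrableOn_Ici_iff_integrableOn_Ioi]
    exact (integrableOn_Ioi_rpow_of_lt (by linarith) ht).const_mul _
  refine (hinteg.integrable_indicator measurableSet_Ici).congr (Eventually.of_forall fun h => ?_)
  dsimp only
  by_cases hh : t ≤ h
  · have hpos : 0 < h := ht.trans_le hh
    rw [Set.indicator_of_mem (Set.mem_Ici.2 hh), paretoPDF_of_le hh,
      ENNReal.toReal_ofReal (by positivity), neg_add, Real.rpow_add hpos, Real.rpow_neg_one]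
    field_simp
  · rw [Set.indicator_of_notMem (by simpa using hh), paretoPDF_of_lt (not_le.1 hh)]
    simp

theorem isProbabilityMeasure_hiddenVariableLaw {τ : ℝ} (hτ : 1 < τ) (ht : 0 < t) :
    IsProbabilityMeasure (hiddenVariableLaw τ t) :=
  isProbabilityMeasure_paretoMeasure ht (sub_pos.2 hτ)

theorem hiddenVariableMean_pos {τ : ℝ} (hτ : 2 < τ) (ht : 0 < t) :
    0 < hiddenVariableMean τ t := by
  have := isProbabilityMeasure_hiddenVariableLaw (one_lt_two.trans hτ) ht
  have hle := integral_mono_ae (μ := hiddenVariableLaw τ t) (integrable_const t)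
    (integrable_id_paretoMeasure ht (by linarith)) (ae_paretoMeasure_ge t (τ - 1))
  exact ht.trans_le (by simpa [hiddenVariableMean] using hle)

end Pareto

section Copies

variable {V W : Type*}

theorem graphletCount_mul_card_iso (H : SimpleGraph V) (G : SimpleGraph W) :
    graphletCount H G * Nat.card (H ≃g H) = Nat.card (H ↪g G) := by
  let iso (S : {S : Set W | Nonempty (G.induce S ≃g H)}) : H ≃g G.induce S.1 := S.2.some.symm
  let embed (p : {S : Set W | Nonempty (G.induce S ≃g H)} × (H ≃g H)) : H ↪g G :=
    (SimpleGraph.Embedding.induce p.1.1).comp ((iso p.1).comp p.2).toEmbedding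
  have hrange (p) : Set.range (embed p) = p.1.1 := by
    ext w
    constructor
    · rintro ⟨v, rfl⟩
      exact (iso p.1 (p.2 v)).2
    · intro hw
      exact ⟨p.2.symm ((iso p.1).symm ⟨w, hw⟩), by simp [embed]⟩
  have hbij : Function.Bijective embed := by
    constructor
    · rintro ⟨S, α⟩ ⟨T, β⟩ hST
      obtain rfl : S = T := Subtype.ext (by rw [← hrange (S, α), hST, hrange (T, β)])
      congr 1
      ext v
      exact (iso S).injective (Subtype.ext (DFunLike.congr_fun hST v))
    · intro φ
      let S : {S : Set W | Nonempty (G.induce S ≃g H)} :=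
        ⟨Set.range φ, ⟨φ.isoInduceRange.symm⟩⟩
      refine ⟨(S, (iso S).symm.comp φ.isoInduceRange), ?_⟩
      ext v
      exact congrArg Subtype.val ((iso S).apply_symm_apply (φ.isoInduceRange v))
  rw [← Nat.card_congr (Equiv.ofBijective embed hbij), Nat.card_prod, graphletCount,
    Nat.card_coe_set_eq]

theorem card_iso_self_ne_zero [Finite V] (H : SimpleGraph V) : Nat.card (H ≃g H) ≠ 0 :=
  have : Finite (H ≃g H) := DFunLike.finite _
  Nat.card_pos.ne'

theorem card_embedding_eq_sum_comap [Fintype (V ↪ W)] (H : SimpleGraph V) (G : SimpleGraph W) :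
    (Nat.card (H ↪g G) : ℝ) =
      ∑ φ : V ↪ W, {G : SimpleGraph W | G.comap φ = H}.indicator (fun _ => (1 : ℝ)) G := by
  classical
  let e : (H ↪g G) ≃ {φ : V ↪ W // G.comap φ = H} :=
    { toFun := fun φ => ⟨φ.toEmbedding, φ.comap_eq⟩
      invFun := fun φ => ⟨φ.1, by simp [← φ.2]⟩
      left_inv := fun _ => rfl
      right_inv := fun _ => rfl }
  rw [Nat.card_congr e, Nat.card_eq_fintype_card, Fintype.card_subtype]
  simp [Set.indicator_apply]

end Copies

section RandomGraph

variable {V : Type*}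

/-- The graph formed by the pairs `e` with `y e < p e`. If the numbers `y e` are independent and
uniform on the unit interval, this is the random graph in which the pairs are joined independently,
the pair `e` with probability `p e`. -/
def inhomogeneousGraph (p : Sym2 V → ℝ) (y : Sym2 V → unitInterval) : SimpleGraph V :=
  SimpleGraph.fromEdgeSet {e | (y e : ℝ) < p e}

theorem inhomogeneousGraph_eq_iff {p : Sym2 V → ℝ} {y : Sym2 V → unitInterval}
    {H : SimpleGraph V} :
    inhomogeneousGraph p y = H ↔
      (∀ e ∈ H.edgeSet, (y e : ℝ) < p e) ∧ ∀ e ∈ Hᶜ.edgeSet, p e ≤ y e := by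
  simp only [SimpleGraph.ext_iff, funext_iff, inhomogeneousGraph, Sym2.forall,
    SimpleGraph.fromEdgeSet_adj, SimpleGraph.mem_edgeSet, SimpleGraph.compl_adj, ← not_lt,
    Set.mem_ofPred_eq, eq_iff_iff]
  constructor
  · exact fun h => ⟨fun u v huv => ((h u v).2 huv).1,
      fun u v huv hlt => huv.2 ((h u v).1 ⟨hlt, huv.1⟩)⟩
  · refine fun h u v => ⟨fun huv => ?_, fun huv => ⟨h.1 u v huv, huv.ne⟩⟩
    by_contra hadj
    exact h.2 u v ⟨huv.2, hadj⟩ huv.1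

open scoped Classical in
theorem volume_inhomogeneousGraph_eq [Fintype V] {p : Sym2 V → ℝ}
    (hp : ∀ e, p e ∈ Set.Icc 0 1) (H : SimpleGraph V) :
    Measure.pi (fun _ : Sym2 V => (volume : Measure unitInterval))
        {y | inhomogeneousGraph p y = H} =
      ENNReal.ofReal ((∏ e ∈ H.edgeFinset, p e) * ∏ e ∈ Hᶜ.edgeFinset, (1 - p e)) := by
  lift p to Sym2 V → unitInterval using hp
  have hset : {y | inhomogeneousGraph (fun e => (p e : ℝ)) y = H} = Set.univ.pi fun e =>
      (if e ∈ H.edgeFinset then Set.Iio (p e) else Set.univ) ∩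
        if e ∈ Hᶜ.edgeFinset then Set.Ici (p e) else Set.univ := by
    ext y
    simp only [Set.mem_ofPred_eq, inhomogeneousGraph_eq_iff, ← SimpleGraph.mem_edgeFinset,
      ← forall_and, Set.mem_univ_pi, Set.mem_inter_iff, Set.mem_ite_univ_right, Set.mem_Iio,
      Set.mem_Ici, Subtype.coe_lt_coe, Subtype.coe_le_coe]
  have hvolume (e : Sym2 V) :
      volume ((if e ∈ H.edgeFinset then Set.Iio (p e) else Set.univ) ∩
        if e ∈ Hᶜ.edgeFinset then Set.Ici (p e) else Set.univ) =
      (if e ∈ H.edgeFinset then ENNReal.ofReal (p e) else 1) *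
        if e ∈ Hᶜ.edgeFinset then ENNReal.ofReal (1 - p e) else 1 := by
    have hdisjoint : e ∈ H.edgeFinset → e ∉ Hᶜ.edgeFinset := by
      induction e with | _ u v
      simp +contextual
    split_ifs <;> simp_all
  rw [hset, Measure.pi_pi]
  simp only [hvolume, Finset.prod_mul_distrib, Finset.prod_ite_mem, Finset.univ_inter]
  rw [ENNReal.ofReal_mul (Finset.prod_nonneg fun e _ => (p e).2.1),
    ENNReal.ofReal_prod_of_nonneg fun e _ => (p e).2.1,
    ENNReal.ofReal_prod_of_nonneg fun e _ => sub_nonneg.2 (p e).2.2]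

/-- The connection probabilities of the pairs of vertices with hidden variables `h`. -/
def pairProb (τ hmin : ℝ) (n : ℕ) (h : V → ℝ) : Sym2 V → ℝ :=
  Sym2.lift ⟨fun u v => connectionProb τ hmin n (h u) (h v), fun u v => by
    simp only [connectionProb, mul_comm]⟩

theorem comap_hiddenVariableGraph (τ hmin : ℝ) {n : ℕ} (ω : HiddenVariableSample n)
    (φ : V ↪ Fin n) :
    (hiddenVariableGraph τ hmin n ω).comap φ =
      inhomogeneousGraph (pairProb τ hmin n (ω.1 ∘ φ)) (ω.2 ∘ Sym2.map φ) := by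
  ext u v
  simp [hiddenVariableGraph, inhomogeneousGraph, pairProb, and_comm]

theorem measurable_pairProb (τ hmin : ℝ) (n : ℕ) (e : Sym2 V) :
    Measurable fun h : V → ℝ => pairProb τ hmin n h e := by
  induction e with | _ u v
  simp only [pairProb, Sym2.lift_mk, connectionProb]
  fun_prop

theorem measurableSet_inhomogeneousGraph_eq [Finite V] (τ hmin : ℝ) (n : ℕ) (H : SimpleGraph V) :
    MeasurableSet {ω : (V → ℝ) × (Sym2 V → unitInterval) |
      inhomogeneousGraph (pairProb τ hmin n ω.1) ω.2 = H} := by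
  have hprob (e : Sym2 V) : Measurable fun ω : (V → ℝ) × (Sym2 V → unitInterval) =>
      pairProb τ hmin n ω.1 e := (measurable_pairProb τ hmin n e).comp measurable_fst
  have hunif (e : Sym2 V) : Measurable fun ω : (V → ℝ) × (Sym2 V → unitInterval) =>
      (ω.2 e : ℝ) := by fun_prop
  simp only [inhomogeneousGraph_eq_iff, Set.ofPred_and, Set.ofPred_forall]
  exact (MeasurableSet.iInter fun e => .iInter fun _ => measurableSet_lt (hunif e) (hprob e)).inter
    (MeasurableSet.iInter fun e => .iInter fun _ => measurableSet_le (hprob e) (hunif e))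

open scoped Classical in
/-- The probability that the graph on the vertex set `V`, with the hidden variables and connection
probabilities of the model on `n` vertices, is `H`. -/
def inducedProb [Fintype V] (τ hmin : ℝ) (n : ℕ) (H : SimpleGraph V) : ℝ :=
  ((Measure.pi fun _ : V => hiddenVariableLaw τ hmin).prod
    (Measure.pi fun _ : Sym2 V => (volume : Measure unitInterval))).real
      {ω | inhomogeneousGraph (pairProb τ hmin n ω.1) ω.2 = H}

/-- The value of `L` for which `√(μ n) * exp (-L)` is the lower bound `hmin` for the hidden
variables. -/
def logCutoff (τ hmin : ℝ) (n : ℕ) : ℝ := Real.log (√(hiddenVariableMean τ hmin * n) / hmin)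

theorem pairProb_mul_exp_logCutoff {τ hmin : ℝ} (hτ : 2 < τ) (hh : 0 < hmin) {n : ℕ} (hn : 0 < n)
    (x : V → ℝ) (e : Sym2 V) :
    pairProb τ hmin n (fun v => hmin * Real.exp (logCutoff τ hmin n + x v)) e =
      Real.exp (min (e.map x).add 0) := by
  have hscale : 0 < hiddenVariableMean τ hmin * n :=
    mul_pos (hiddenVariableMean_pos hτ hh) (Nat.cast_pos.2 hn)
  have hvar (v : V) : hmin * Real.exp (logCutoff τ hmin n + x v) =
      √(hiddenVariableMean τ hmin * n) * Real.exp (x v) := by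
    rw [logCutoff, Real.exp_add, Real.exp_log (by positivity), ← mul_assoc,
      mul_div_cancel₀ _ hh.ne']
  induction e with | _ u v
  simp only [hvar, pairProb, Sym2.lift_mk, connectionProb, Sym2.map_mk, Sym2.add_mk,
    Real.exp_monotone.map_min, Real.exp_zero]
  rw [mul_mul_mul_comm, Real.mul_self_sqrt hscale.le, mul_div_cancel_left₀ _ hscale.ne',
    Real.exp_add]

open scoped Classical in
theorem volume_inhomogeneousGraph_mul_exp_logCutoff_eq [Fintype V] {τ hmin : ℝ} (hτ : 2 < τ)
    (hh : 0 < hmin) {n : ℕ} (hn : 0 < n) (x : V → ℝ) (H : SimpleGraph V) :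
    Measure.pi (fun _ : Sym2 V => (volume : Measure unitInterval)) {y | inhomogeneousGraph
        (pairProb τ hmin n fun v => hmin * Real.exp (logCutoff τ hmin n + x v)) y = H} =
      ENNReal.ofReal
        (Real.exp (∑ e ∈ H.edgeFinset, min (e.map x).add 0) * nonedgeProb H x) := by
  rw [funext (pairProb_mul_exp_logCutoff hτ hh hn x), Real.exp_sum]
  exact volume_inhomogeneousGraph_eq
    (fun e => ⟨(Real.exp_pos _).le, Real.exp_le_one_iff.2 (min_le_right _ _)⟩) H

theorem inducedProb_eq [Fintype V] {τ hmin : ℝ} (hτ : 2 < τ) (hh : 0 < hmin) {n : ℕ} (hn : 0 < n)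
    (H : SimpleGraph V) :
    inducedProb τ hmin n H =
      ((τ - 1) * Real.exp (-(τ - 1) * logCutoff τ hmin n)) ^ Fintype.card V *
        (graphletIntegral τ H (logCutoff τ hmin n)).toReal := by
  classical
  set L := logCutoff τ hmin n
  have hτ' : 0 < τ - 1 := by linarith
  have hcond (x : V → ℝ) :
      (∏ v, ENNReal.ofReal ((τ - 1) * Real.exp (-(τ - 1) * (L + x v)))) *
        Measure.pi (fun _ : Sym2 V => (volume : Measure unitInterval)) {y | inhomogeneousGraph
          (pairProb τ hmin n fun v => hmin * Real.exp (L + x v)) y = H} =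
      ENNReal.ofReal (((τ - 1) * Real.exp (-(τ - 1) * L)) ^ Fintype.card V) *
        ENNReal.ofReal (Real.exp (logWeight τ H x) * nonedgeProb H x) := by
    have hdensity : ∏ v, (τ - 1) * Real.exp (-(τ - 1) * (L + x v)) =
        ((τ - 1) * Real.exp (-(τ - 1) * L)) ^ Fintype.card V *
          Real.exp (-(τ - 1) * ∑ v, x v) := by
      simp only [mul_add, Real.exp_add, ← mul_assoc, Finset.prod_mul_distrib, Finset.prod_const,
        Finset.card_univ, Finset.mul_sum, Real.exp_sum, mul_pow]
    have hweight : Real.exp (logWeight τ H x) = Real.exp (-(τ - 1) * ∑ v, x v) *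
        Real.exp (∑ e ∈ H.edgeFinset, min (e.map x).add 0) := by
      rw [logWeight, ← Real.exp_add, neg_mul, sub_eq_neg_add]
    rw [volume_inhomogeneousGraph_mul_exp_logCutoff_eq hτ hh hn, hweight, mul_assoc (Real.exp _),
      ← ENNReal.ofReal_prod_of_nonneg fun _ _ => by positivity, hdensity,
      ENNReal.ofReal_mul (by positivity), mul_assoc, ← ENNReal.ofReal_mul (by positivity)]
  have hmeas := measurableSet_inhomogeneousGraph_eq τ hmin n H
  rw [inducedProb, Measure.real, Measure.prod_apply hmeas, hiddenVariableLaw,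
    lintegral_pi_paretoMeasure hh hτ' L (measurable_measure_prodMk_left hmeas)]
  simp only [Set.preimage_ofPred_eq, hcond]
  rw [lintegral_const_mul' _ _ ENNReal.ofReal_ne_top, ENNReal.toReal_mul,
    ENNReal.toReal_ofReal (by positivity), graphletIntegral]

end RandomGraph

section Expectation

theorem measurePreserving_comp_injective {ι κ α : Type*} [Fintype ι] [Fintype κ]
    [MeasurableSpace α] (μ : Measure α) [IsProbabilityMeasure μ] {φ : ι → κ}
    (hφ : Function.Injective φ) :
    MeasurePreserving (fun x : κ → α => x ∘ φ) (Measure.pi fun _ => μ)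
      (Measure.pi fun _ => μ) := by
  have hindep : iIndepFun (fun i (x : κ → α) => x (φ i)) (Measure.pi fun _ => μ) :=
    (iIndepFun_pi (X := fun _ => id) fun _ => aemeasurable_id).precomp hφ
  refine ⟨by fun_prop, ?_⟩
  have hmap := (iIndepFun_iff_map_fun_eq_pi_map fun i =>
    (measurable_pi_apply (φ i)).aemeasurable).1 hindep
  simp only [(measurePreserving_eval (fun _ : κ => μ) (φ _)).map_eq] at hmap
  exact hmap

variable {V : Type*} {τ hmin : ℝ}

theorem measurableSet_comap_hiddenVariableGraph_eq [Finite V] {n : ℕ} (H : SimpleGraph V)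
    (φ : V ↪ Fin n) :
    MeasurableSet {ω | (hiddenVariableGraph τ hmin n ω).comap φ = H} := by
  simp only [comap_hiddenVariableGraph]
  exact (by fun_prop : Measurable fun ω : HiddenVariableSample n =>
    (ω.1 ∘ φ, ω.2 ∘ Sym2.map φ)) (measurableSet_inhomogeneousGraph_eq τ hmin n H)

variable [Fintype V]

theorem measureReal_comap_hiddenVariableGraph_eq (hτ : 1 < τ) (hh : 0 < hmin) {n : ℕ}
    (H : SimpleGraph V) (φ : V ↪ Fin n) :
    (hiddenVariableMeasure τ hmin n).real {ω | (hiddenVariableGraph τ hmin n ω).comap φ = H} =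
      inducedProb τ hmin n H := by
  classical
  have := isProbabilityMeasure_hiddenVariableLaw hτ hh
  have hpres := (measurePreserving_comp_injective (hiddenVariableLaw τ hmin) φ.injective).prod
    (measurePreserving_comp_injective (volume : Measure unitInterval)
      (Sym2.map.injective φ.injective))
  rw [inducedProb, ← hpres.measureReal_preimage
    (measurableSet_inhomogeneousGraph_eq τ hmin n H).nullMeasurableSet]
  simp only [comap_hiddenVariableGraph]
  rfl

theorem expectedGraphletCount_eq (hτ : 1 < τ) (hh : 0 < hmin) (n : ℕ) (H : SimpleGraph V) :
    expectedGraphletCount τ hmin H n =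
      n.descFactorial (Fintype.card V) * inducedProb τ hmin n H / Nat.card (H ≃g H) := by
  classical
  have := isProbabilityMeasure_hiddenVariableLaw hτ hh
  have : IsProbabilityMeasure (hiddenVariableMeasure τ hmin n) := by
    unfold hiddenVariableMeasure
    infer_instance
  have hcard : (Nat.card (H ≃g H) : ℝ) ≠ 0 := Nat.cast_ne_zero.2 (card_iso_self_ne_zero H)
  have hcount (ω : HiddenVariableSample n) :
      (graphletCount H (hiddenVariableGraph τ hmin n ω) : ℝ) * Nat.card (H ≃g H) =
        ∑ φ : V ↪ Fin n, {ω | (hiddenVariableGraph τ hmin n ω).comap φ = H}.indicator 1 ω := by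
    rw [← Nat.cast_mul, graphletCount_mul_card_iso, card_embedding_eq_sum_comap]
    rfl
  have hmeas (φ : V ↪ Fin n) :=
    measurableSet_comap_hiddenVariableGraph_eq (τ := τ) (hmin := hmin) H φ
  rw [eq_div_iff hcard, expectedGraphletCount, ← integral_mul_const,
    integral_congr_ae (.of_forall hcount),
    integral_finsetSum _ fun φ _ => (integrable_const 1).indicator (hmeas φ)]
  simp only [integral_indicator_one (hmeas _), measureReal_comap_hiddenVariableGraph_eq hτ hh]
  rw [Finset.sum_const, Finset.card_univ, Fintype.card_embedding_eq, Fintype.card_fin,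
    nsmul_eq_mul]

theorem isTheta_expectedGraphletCount (hτ : 1 < τ) (hh : 0 < hmin) (H : SimpleGraph V) :
    (fun n => expectedGraphletCount τ hmin H n) =Θ[atTop]
      fun n => (n : ℝ) ^ Fintype.card V * inducedProb τ hmin n H := by
  have hcard : (Nat.card (H ≃g H) : ℝ)⁻¹ ≠ 0 :=
    inv_ne_zero (Nat.cast_ne_zero.2 (card_iso_self_ne_zero H))
  simp only [expectedGraphletCount_eq hτ hh, div_eq_inv_mul]
  exact ((isEquivalent_descFactorial _).isTheta.mul (isTheta_refl _ _)).const_mul_left hcard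

theorem logCutoff_eq (hτ : 2 < τ) (hh : 0 < hmin) {n : ℕ} (hn : 0 < n) :
    logCutoff τ hmin n =
      Real.log n / 2 + (Real.log (hiddenVariableMean τ hmin) / 2 - Real.log hmin) := by
  have hmean := hiddenVariableMean_pos hτ hh
  have hn' : (0 : ℝ) < n := Nat.cast_pos.2 hn
  rw [logCutoff, Real.log_div (by positivity) hh.ne', Real.log_sqrt (by positivity),
    Real.log_mul hmean.ne' hn'.ne']
  ring

theorem tendsto_logCutoff_atTop (hτ : 2 < τ) (hh : 0 < hmin) :
    Tendsto (logCutoff τ hmin) atTop atTop := by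
  have hlog : Tendsto (fun n : ℕ => Real.log n / 2) atTop atTop :=
    (Real.tendsto_log_atTop.comp tendsto_natCast_atTop_atTop).atTop_div_const zero_lt_two
  refine (tendsto_atTop_add_const_right _
    (Real.log (hiddenVariableMean τ hmin) / 2 - Real.log hmin) hlog).congr' ?_
  filter_upwards [eventually_gt_atTop 0] with n hn
  exact (logCutoff_eq hτ hh hn).symm

theorem isTheta_exp_logCutoff_mul (hτ : 2 < τ) (hh : 0 < hmin) (s : ℝ) :
    (fun n => Real.exp (logCutoff τ hmin n * s)) =Θ[atTop] fun n : ℕ => (n : ℝ) ^ (s / 2) := by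
  set c := Real.log (hiddenVariableMean τ hmin) / 2 - Real.log hmin
  have hexp : (fun n => Real.exp (logCutoff τ hmin n * s)) =ᶠ[atTop]
      fun n : ℕ => Real.exp (c * s) * (n : ℝ) ^ (s / 2) := by
    filter_upwards [eventually_gt_atTop 0] with n hn
    rw [logCutoff_eq hτ hh hn, Real.rpow_def_of_pos (Nat.cast_pos.2 hn), ← Real.exp_add]
    simp only [c]
    ring_nf
  exact hexp.isTheta.trans ((isTheta_refl _ _).const_mul_left (Real.exp_ne_zero _))

theorem isTheta_inducedProb (hτ : 2 < τ) (hh : 0 < hmin) {H : SimpleGraph V}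
    {P : VertexPartition V} (hP : IsOptimizer τ H P)
    (hunique : ∀ Q, IsOptimizer τ H Q → Q = P) :
    (fun n => inducedProb τ hmin n H) =Θ[atTop] fun n : ℕ =>
      (n : ℝ) ^ ((τ - 1) / 2 * (objective τ H P - Fintype.card V)) := by
  have hτ' : (τ - 1) ^ Fintype.card V ≠ 0 := pow_ne_zero _ (by linarith)
  have hprob : (fun n => inducedProb τ hmin n H) =ᶠ[atTop] fun n =>
      (τ - 1) ^ Fintype.card V * (Real.exp (logCutoff τ hmin n * (-(τ - 1) * Fintype.card V)) *
        (graphletIntegral τ H (logCutoff τ hmin n)).toReal) := by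
    filter_upwards [eventually_gt_atTop 0] with n hn
    rw [inducedProb_eq hτ hh hn, mul_pow, ← Real.exp_nat_mul, mul_assoc]
    ring_nf
  have hintegral : (fun n => (graphletIntegral τ H (logCutoff τ hmin n)).toReal) =Θ[atTop]
      fun n => Real.exp (logCutoff τ hmin n * ((τ - 1) * objective τ H P)) :=
    (isTheta_graphletIntegral (by linarith) hP hunique).imp
      (·.comp_tendsto (tendsto_logCutoff_atTop hτ hh))
      (·.comp_tendsto (tendsto_logCutoff_atTop hτ hh))
  calc _ =Θ[atTop] _ := hprob.isTheta
    _ =Θ[atTop] fun n => Real.exp (logCutoff τ hmin n * (-(τ - 1) * Fintype.card V)) *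
        Real.exp (logCutoff τ hmin n * ((τ - 1) * objective τ H P)) :=
      ((isTheta_refl _ _).mul hintegral).const_mul_left hτ'
    _ =Θ[atTop] _ := by
      simp only [← Real.exp_add, ← mul_add]
      convert isTheta_exp_logCutoff_mul hτ hh _ using 3
      ring

end Expectation

theorem mainTheorem8_general {V : Type*} [Fintype V] (H : SimpleGraph V) (τ hmin : ℝ)
    (hτ₂ : 2 < τ) (hhmin : 0 < hmin)
    (P : VertexPartition V) (hP : VertexPartition.IsOptimizer τ H P)
    (hunique : ∀ Q : VertexPartition V, VertexPartition.IsOptimizer τ H Q → Q = P) :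
    (fun n : ℕ => expectedGraphletCount τ hmin H n) =Θ[atTop]
        (fun n : ℕ => (n : ℝ) ^ ((3 - τ) / 2 * (Fintype.card V : ℝ)
          + (τ - 1) / 2 * graphletB τ H)) ∧
      graphletB τ H = VertexPartition.objective τ H P := by
  have hB : graphletB τ H = objective τ H P :=
    (graphletB_isGreatest τ H).unique ⟨⟨P, hP.1, rfl⟩, by rintro _ ⟨Q, hQ, rfl⟩; exact hP.2 Q hQ⟩
  have hpow : (fun n : ℕ => (n : ℝ) ^ Fintype.card V *
      (n : ℝ) ^ ((τ - 1) / 2 * (objective τ H P - Fintype.card V))) =ᶠ[atTop] fun n : ℕ =>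
        (n : ℝ) ^ ((3 - τ) / 2 * (Fintype.card V : ℝ) + (τ - 1) / 2 * graphletB τ H) := by
    filter_upwards [eventually_gt_atTop 0] with n hn
    rw [← Real.rpow_natCast, ← Real.rpow_add (Nat.cast_pos.2 hn), hB]
    ring_nf
  exact ⟨(isTheta_expectedGraphletCount (by linarith) hhmin H).trans
    (((isTheta_refl _ _).mul (isTheta_inducedProb hτ₂ hhmin hP hunique)).trans_eventuallyEq hpow),
    hB⟩

end

/-- For `τ ∈ (2, 3)` and a graph `H` on `k` vertices for which the constrained optimization problem
has the unique optimizer `P`, the expected number of induced copies of `H` in the hidden-variable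
model on `n` vertices is of exact order `n ^ ((3 - τ) / 2 * k + (τ - 1) / 2 * B_{g,f}(H))`, and
`B_{g,f}(H)` is the objective at `P`. -/
theorem mainTheorem8 {V : Type*} [Fintype V] (H : SimpleGraph V) (τ hmin : ℝ)
    (hτ₂ : 2 < τ) (hτ₃ : τ < 3) (hhmin : 0 < hmin)
    (P : VertexPartition V) (hP : VertexPartition.IsOptimizer τ H P)
    (hunique : ∀ Q : VertexPartition V, VertexPartition.IsOptimizer τ H Q → Q = P) :
    (fun n : ℕ => expectedGraphletCount τ hmin H n) =Θ[atTop]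
        (fun n : ℕ => (n : ℝ) ^ ((3 - τ) / 2 * (Fintype.card V : ℝ)
          + (τ - 1) / 2 * graphletB τ H)) ∧
      graphletB τ H = VertexPartition.objective τ H P :=
  mainTheorem8_general H τ hmin hτ₂ hhmin P hP hunique
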